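/- Let $1\le p<\infty$, let $\mathcal H$ be a complex Hilbert space, and let $\mathcal H=\mathcal H_+\oplus\mathcal H_-$ be an orthogonal decomposition into two infinite-dimensional closed subspaces, with $E_+$ the orthogonal projection onto $\mathcal H_+$. Let $\mathcal B_p(\mathcal H)$ be the Schatten class of bounded operators $T$ on $\mathcal H$ with $\mathrm{Tr}(|T|^p)<\infty$, and write $[A,B]=AB-BA$. Let $\mathcal A^p=\{A\in\mathcal B(\mathcal H):[A,E_+]\in\mathcal B_p(\mathcal H)\}$, let $\mathcal U_{\mathcal A^p}$ be the group of those invertible elements of the algebra $\mathcal A^p$ that are unitary operators on $\mathcal H$, let $\mathcal P$ be the set of all orthogonal projections in $\mathcal H$, and let $\mathcal P^p=\{P\in\mathcal P:[P,E_+]\in\mathcal B_p(\mathcal H)\}$. Then the orbit $\mathcal O(E_+)=\{UE_+U^*:U\in\mathcal U_{\mathcal A^p}\}$ satisfies $$\mathcal O(E_+)=\{P\in\mathcal P^p:P-E_+\in\mathcal B_p(\mathcal H)\}=\{P\in\mathcal P:P-E_+\in\mathcal B_p(\mathcal H)\}.$$ -/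

import Mathlib

open scoped ENNReal InnerProductSpace

noncomputable section

namespace RestrictedProjections

variable {H : Type*} [NormedAddCommGroup H] [InnerProductSpace ℂ H] [CompleteSpace H]

/-- The sum `∑ᵢ ⟪bᵢ, A bᵢ⟫ ∈ [0, ∞]` of the diagonal of a positive operator `A` along an
orthonormal (Hilbert) basis `b`. -/
def diagSum {ι : Type*} (b : HilbertBasis ι ℂ H) (A : H →L[ℂ] H) : ℝ≥0∞ :=
  ∑' i, ENNReal.ofReal (RCLike.re ⟪b i, A (b i)⟫_ℂ)

/-- The trace `Tr A ∈ [0, ∞]` of a positive operator `A`: the sum of its diagonal along an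
orthonormal basis. For positive `A` the value does not depend on the basis, see
`posTrace_eq_diagSum`. -/
def posTrace (A : H →L[ℂ] H) : ℝ≥0∞ :=
  diagSum (exists_hilbertBasis ℂ H).choose_spec.choose A

theorem ofReal_norm_sq_eq_tsum {H : Type*} [NormedAddCommGroup H] [InnerProductSpace ℂ H]
    {ι : Type*} (b : HilbertBasis ι ℂ H) (x : H) :
    ENNReal.ofReal (‖x‖ ^ 2) = ∑' i, ENNReal.ofReal (‖⟪b i, x⟫_ℂ‖ ^ 2) := by
  have h := b.hasSum_inner_mul_inner x x
  have h2 : HasSum (fun i => ‖⟪b i, x⟫_ℂ‖ ^ 2) (‖x‖ ^ 2) := by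
    have h3 := Complex.hasSum_re h
    rw [inner_self_eq_norm_sq_to_K] at h3
    convert h3 using 1
    · funext i
      rw [← inner_conj_symm x (b i), mul_comm, Complex.mul_conj, Complex.normSq_eq_norm_sq]
      norm_cast
    · norm_cast
  rw [← h2.tsum_eq, ENNReal.ofReal_tsum_of_nonneg (fun i => by positivity) h2.summable]

theorem diagSum_mul_self {ι : Type*} (b : HilbertBasis ι ℂ H) {B : H →L[ℂ] H}
    (hB : IsSelfAdjoint B) : diagSum b (B * B) = ∑' i, ENNReal.ofReal (‖B (b i)‖ ^ 2) := by
  refine tsum_congr fun i => ?_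
  have h : ⟪B (b i), B (b i)⟫_ℂ = ⟪b i, (B * B) (b i)⟫_ℂ := hB.isSymmetric _ _
  rw [← h, inner_self_eq_norm_sq]

theorem diagSum_eq_diagSum {ι κ : Type*} (b : HilbertBasis ι ℂ H) (c : HilbertBasis κ ℂ H)
    {A : H →L[ℂ] H} (hA : 0 ≤ A) : diagSum b A = diagSum c A := by
  obtain ⟨B, hB, rfl⟩ : ∃ B : H →L[ℂ] H, IsSelfAdjoint B ∧ B * B = A :=
    ⟨CFC.sqrt A, (CFC.sqrt_nonneg A).isSelfAdjoint, CFC.sqrt_mul_sqrt_self A hA⟩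
  have hsymm : ∀ x y : H, ⟪B x, y⟫_ℂ = ⟪x, B y⟫_ℂ := hB.isSymmetric
  rw [diagSum_mul_self b hB, diagSum_mul_self c hB]
  simp_rw [ofReal_norm_sq_eq_tsum c (B (b _)), ofReal_norm_sq_eq_tsum b (B (c _))]
  rw [ENNReal.tsum_comm]
  refine tsum_congr fun i => tsum_congr fun j => ?_
  rw [← hsymm, norm_inner_symm]

theorem posTrace_eq_diagSum {ι : Type*} (b : HilbertBasis ι ℂ H) {A : H →L[ℂ] H} (hA : 0 ≤ A) :
    posTrace A = diagSum b A :=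
  diagSum_eq_diagSum _ b hA

/-- The Schatten class `𝓑_p(H)`: the bounded operators `T` with `Tr (|T|^p) < ∞`, where
`|T| = (T* T)^{1/2}` and `|T|^p` is given by the continuous functional calculus. -/
def schatten (H : Type*) [NormedAddCommGroup H] [InnerProductSpace ℂ H] [CompleteSpace H]
    (p : ℝ) : Set (H →L[ℂ] H) :=
  {T | posTrace (CFC.abs T ^ p) < ∞}

/-- `𝓐^p`: the bounded operators `A` whose commutator `[A, E] = A E - E A` lies in `𝓑_p(H)`. -/
def algA (p : ℝ) (E : H →L[ℂ] H) : Set (H →L[ℂ] H) :=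
  {A | A * E - E * A ∈ schatten H p}

/-- The group of invertible elements of the algebra `𝓐^p` (the inverse lies in `𝓐^p` too). -/
def groupG (p : ℝ) (E : H →L[ℂ] H) : Set (H →L[ℂ] H) :=
  {G | G ∈ algA p E ∧ ∃ G' ∈ algA p E, G * G' = 1 ∧ G' * G = 1}

/-- The group of those invertible elements of `𝓐^p` that are unitary operators on `H`. -/
def groupU (p : ℝ) (E : H →L[ℂ] H) : Set (H →L[ℂ] H) :=
  {U | U ∈ groupG p E ∧ U ∈ unitary (H →L[ℂ] H)}

/-- `𝓟(H)`: the set of all orthogonal projections in `H` (`P² = P = P*`). -/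
def projections (H : Type*) [NormedAddCommGroup H] [InnerProductSpace ℂ H] [CompleteSpace H] :
    Set (H →L[ℂ] H) :=
  {P | IsStarProjection P}

/-- `𝓟^p`: the orthogonal projections `P` with `[P, E] ∈ 𝓑_p(H)`. -/
def projectionsP (p : ℝ) (E : H →L[ℂ] H) : Set (H →L[ℂ] H) :=
  {P | P ∈ projections H ∧ P * E - E * P ∈ schatten H p}

/-- The orbit `{U E U* : U unitary in 𝓐^p}` of `E`. -/
def orbit (p : ℝ) (E : H →L[ℂ] H) : Set (H →L[ℂ] H) :=
  {P | ∃ U ∈ groupU p E, P = U * E * star U}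

end RestrictedProjections

end

open scoped ENNReal InnerProductSpace

noncomputable section

namespace RestrictedProjections

universe u

section InnerProduct

variable {H : Type*} [NormedAddCommGroup H] [InnerProductSpace ℂ H]

theorem mem_orthogonal_of_hilbertBasis {J : Type*} {L : Submodule ℂ H} [L.HasOrthogonalProjection]
    (c : HilbertBasis J ℂ L) {x : H} (hx : ∀ j, ⟪x, (c j : H)⟫_ℂ = 0) : x ∈ Lᗮ := by
  refine (Submodule.mem_orthogonal' L x).2 fun y hy => ?_
  have h := c.hasSum_inner_mul_inner (L.orthogonalProjectionOnto x) ⟨y, hy⟩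
  have h0 : ∀ z : L, ⟪L.orthogonalProjectionOnto x, z⟫_ℂ = ⟪x, (z : H)⟫_ℂ := fun z =>
    Submodule.inner_orthogonalProjectionOnto_eq_of_mem_right z x
  simp only [h0, hx, zero_mul] at h
  exact h.unique hasSum_zero

theorem isClosed_of_hasOrthogonalProjection (K : Submodule ℂ H) [K.HasOrthogonalProjection] :
    IsClosed (K : Set H) := by
  rw [← Submodule.orthogonal_orthogonal K]
  exact Submodule.isClosed_orthogonal _

/-- If all but finitely many members of a Hilbert basis of `K` have nonzero projection on the
infinite-dimensional subspace `L`, then the Hilbert dimension of `K` is at most that of `L`. -/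
theorem mk_le_mk_of_hilbertBasis {I J : Type u} [Infinite J] {K L : Submodule ℂ H}
    [L.HasOrthogonalProjection] (b : HilbertBasis I ℂ K) (c : HilbertBasis J ℂ L)
    (hfin : {i | (b i : H) ∈ Lᗮ}.Finite) : Cardinal.mk I ≤ Cardinal.mk J := by
  have hcov : (Set.univ : Set I) ⊆
      {i | (b i : H) ∈ Lᗮ} ∪ ⋃ j, {i | ⟪(b i : H), (c j : H)⟫_ℂ ≠ 0} := by
    intro i _
    by_cases h : (b i : H) ∈ Lᗮ
    · exact .inl h
    · right
      by_contra hcon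
      simp only [Set.mem_iUnion, Set.mem_ofPred_eq, not_exists, not_not] at hcon
      exact h (mem_orthogonal_of_hilbertBasis c hcon)
  have hcount : ∀ j, {i | ⟪(b i : H), (c j : H)⟫_ℂ ≠ 0}.Countable := fun j => by
    have hb : Orthonormal ℂ fun i => (b i : H) :=
      b.orthonormal.comp_linearIsometry K.subtypeₗᵢ
    refine (hb.inner_products_summable (x := (c j : H))).countable_support.mono fun i hi => ?_
    simpa using hi
  have hJ : Cardinal.aleph0 ≤ Cardinal.mk J := Cardinal.aleph0_le_mk J
  calc Cardinal.mk I = Cardinal.mk (Set.univ : Set I) := Cardinal.mk_univ.symm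
    _ ≤ _ := Cardinal.mk_le_mk_of_subset hcov
    _ ≤ _ := Cardinal.mk_union_le _ _
    _ ≤ Cardinal.mk J + Cardinal.mk J * Cardinal.mk J := by
      refine add_le_add ((Cardinal.lt_aleph0_iff_set_finite.2 hfin).le.trans hJ) ?_
      refine (Cardinal.mk_iUnion_le _).trans (mul_le_mul' le_rfl ?_)
      exact ciSup_le' fun j => (Cardinal.le_aleph0_iff_set_countable.2 (hcount j)).trans hJ
    _ = Cardinal.mk J := by rw [Cardinal.mul_eq_self hJ, Cardinal.add_eq_self hJ]

theorem finite_setOf_hilbertBasis_mem {I : Type*} {K N : Submodule ℂ H} [FiniteDimensional ℂ N]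
    (b : HilbertBasis I ℂ K) : {i | (b i : H) ∈ N}.Finite := by
  have hb : Orthonormal ℂ fun i => (b i : H) := b.orthonormal.comp_linearIsometry K.subtypeₗᵢ
  have hli : LinearIndependent ℂ fun i : {i | (b i : H) ∈ N} => (⟨b i, i.2⟩ : N) := by
    refine LinearIndependent.of_comp N.subtype ?_
    exact hb.linearIndependent.comp _ Subtype.val_injective
  exact hli.finite

theorem infinite_of_hilbertBasis {I : Type*} {K : Submodule ℂ H} (b : HilbertBasis I ℂ K)
    (hK : ¬ FiniteDimensional ℂ K) : Infinite I := by
  by_contra h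
  rw [not_infinite_iff_finite] at h
  have : Fintype I := Fintype.ofFinite I
  exact hK b.toOrthonormalBasis.toBasis.finiteDimensional_of_finite

theorem finiteDimensional_of_inf_orthogonal {K L : Submodule ℂ H} [K.HasOrthogonalProjection]
    [FiniteDimensional ℂ K] [FiniteDimensional ℂ ↥(L ⊓ Kᗮ)] : FiniteDimensional ℂ L := by
  let f : L →ₗ[ℂ] K := (K.orthogonalProjectionOnto : H →ₗ[ℂ] K) ∘ₗ L.subtype
  have hker : FiniteDimensional ℂ (LinearMap.ker f) := by
    refine Module.Finite.of_injective
      (LinearMap.codRestrict (L ⊓ Kᗮ) (L.subtype ∘ₗ (LinearMap.ker f).subtype) fun x => ?_) ?_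
    · refine ⟨x.1.2, ?_⟩
      have h : K.orthogonalProjectionOnto (x.1 : H) = 0 := x.2
      exact Submodule.orthogonalProjectionOnto_eq_zero_iff.1 h
    · intro x y hxy
      exact Subtype.ext (Subtype.ext (congrArg (Subtype.val : ↥(L ⊓ Kᗮ) → H) hxy))
  have : FiniteDimensional ℂ (L ⧸ LinearMap.ker f) :=
    Module.Finite.of_injective _ f.quotKerEquivRange.injective
  exact Module.Finite.of_submodule_quotient (LinearMap.ker f)

theorem apply_apply_eq_of_mem_inf_orthogonal {K L : Submodule ℂ H} [K.HasOrthogonalProjection]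
    [L.HasOrthogonalProjection] {v : H} (hv : v ∈ L ⊓ Kᗮ) :
    (K.starProjection - L.starProjection) ((K.starProjection - L.starProjection) v) = v := by
  have h1 : L.starProjection v = v := Submodule.starProjection_eq_self_iff.2 hv.1
  have h2 : K.starProjection v = 0 := (K.starProjection_apply_eq_zero_iff).2 hv.2
  simp [h1, h2]

end InnerProduct

section Schatten

variable {H : Type u} [NormedAddCommGroup H] [InnerProductSpace ℂ H] [CompleteSpace H]

theorem posTrace_mono {A B : H →L[ℂ] H} (h : A ≤ B) : posTrace A ≤ posTrace B := by
  refine ENNReal.tsum_le_tsum fun i => ENNReal.ofReal_le_ofReal ?_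
  have := ((ContinuousLinearMap.le_def A B).1 h).re_inner_nonneg_right
    ((exists_hilbertBasis ℂ H).choose_spec.choose i)
  simpa [inner_sub_right] using this

theorem posTrace_unitary_conj {A U : H →L[ℂ] H} (hA : 0 ≤ A) (hU : U ∈ unitary (H →L[ℂ] H)) :
    posTrace (U * A * star U) = posTrace A := by
  obtain ⟨w, b, -⟩ := exists_hilbertBasis ℂ H
  classical
  let e : H ≃ₗᵢ[ℂ] H := Unitary.linearIsometryEquiv ⟨U, hU⟩
  let c : HilbertBasis w ℂ H := .ofRepr (e.trans b.repr)
  have hc : ∀ i, c i = star U (b i) := by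
    intro i
    have h1 : e (c i) = b i := by
      apply b.repr.injective
      rw [b.repr_self, ← c.repr_self]
      rfl
    have h2 : U (c i) = b i := h1
    rw [← h2, ← mul_apply_eq_comp, (Unitary.mem_iff.1 hU).1]
    rfl
  rw [posTrace_eq_diagSum b (star_right_conjugate_nonneg hA U), posTrace_eq_diagSum c hA]
  refine tsum_congr fun i => ?_
  rw [hc]
  simp [ContinuousLinearMap.star_eq_adjoint, ContinuousLinearMap.adjoint_inner_left]

theorem rpow_unitary_conj {A U : H →L[ℂ] H} (hA : 0 ≤ A) (hU : U ∈ unitary (H →L[ℂ] H))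
    {p : ℝ} (hp : 0 ≤ p) : (U * A * star U) ^ p = U * A ^ p * star U := by
  have h := StarAlgHomClass.map_cfc (R := ℝ) (S := ℝ) (Unitary.conjStarAlgAut ℝ (H →L[ℂ] H) ⟨U, hU⟩)
    (fun x : ℝ => x ^ p) A (Real.continuous_rpow_const hp).continuousOn
    (by
      change Continuous fun x => U * x * star U
      fun_prop) hA.isSelfAdjoint
    (star_right_conjugate_nonneg hA U).isSelfAdjoint
  rw [CFC.rpow_eq_cfc_real (star_right_conjugate_nonneg hA U), CFC.rpow_eq_cfc_real hA]
  exact h.symm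

theorem abs_mul_star_unitary (T : H →L[ℂ] H) {U : H →L[ℂ] H} (hU : U ∈ unitary (H →L[ℂ] H)) :
    CFC.abs (T * star U) = U * CFC.abs T * star U := by
  refine CFC.sqrt_unique ?_ (star_right_conjugate_nonneg (CFC.abs_nonneg T) U)
  calc U * CFC.abs T * star U * (U * CFC.abs T * star U)
      = U * CFC.abs T * (star U * U) * CFC.abs T * star U := by noncomm_ring
    _ = U * (CFC.abs T * CFC.abs T) * star U := by
      rw [(Unitary.mem_iff.1 hU).1]; noncomm_ring
    _ = star (T * star U) * (T * star U) := by
      rw [CFC.abs_mul_abs, star_mul, star_star]; noncomm_ring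

theorem schatten_mul_star_unitary {T U : H →L[ℂ] H} {p : ℝ} (hp : 0 ≤ p) (hT : T ∈ schatten H p)
    (hU : U ∈ unitary (H →L[ℂ] H)) : T * star U ∈ schatten H p := by
  change posTrace _ < ∞
  rw [abs_mul_star_unitary T hU, rpow_unitary_conj (CFC.abs_nonneg T) hU hp,
    posTrace_unitary_conj CFC.rpow_nonneg hU]
  exact hT

theorem schatten_mul_unitary {T U : H →L[ℂ] H} {p : ℝ} (hp : 0 ≤ p) (hT : T ∈ schatten H p)
    (hU : U ∈ unitary (H →L[ℂ] H)) : T * U ∈ schatten H p := by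
  simpa using schatten_mul_star_unitary hp hT (Unitary.star_mem hU)

theorem schatten_unitary_mul {T U : H →L[ℂ] H} {p : ℝ} (hT : T ∈ schatten H p)
    (hU : U ∈ unitary (H →L[ℂ] H)) : U * T ∈ schatten H p := by
  change posTrace (CFC.abs (U * T) ^ p) < ∞
  have : CFC.abs (U * T) = CFC.abs T := by
    rw [CFC.abs, CFC.abs, star_mul, mul_assoc, ← mul_assoc (star U), (Unitary.mem_iff.1 hU).1,
      one_mul]
  rw [this]
  exact hT

theorem schatten_neg {T : H →L[ℂ] H} {p : ℝ} (hT : T ∈ schatten H p) : -T ∈ schatten H p := by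
  change posTrace (CFC.abs (-T) ^ p) < ∞
  rw [CFC.abs_neg]
  exact hT

/-- An operator whose square modulus is `|D|² - |D|⁴` is in the Schatten class with `D`. -/
theorem schatten_of_star_mul_self_eq {T D : H →L[ℂ] H} {p : ℝ} (hp : 0 ≤ p)
    (hD : D ∈ schatten H p)
    (h : star T * T = CFC.abs D ^ 2 - CFC.abs D ^ 4) : T ∈ schatten H p := by
  refine lt_of_le_of_lt (posTrace_mono ?_) hD
  set S := CFC.abs D with hS
  have hS0 : 0 ≤ S := CFC.abs_nonneg D
  have hSa : IsSelfAdjoint S := hS0.isSelfAdjoint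
  have hg : star T * T = cfc (fun x : ℝ => x ^ 2 - x ^ 4) S := by
    rw [h, cfc_sub (fun x : ℝ => x ^ 2) (fun x : ℝ => x ^ 4) S, cfc_pow_id S 2, cfc_pow_id S 4]
  have hspec : ∀ x ∈ spectrum ℝ S, 0 ≤ x ^ 2 - x ^ 4 := by
    rw [← cfc_nonneg_iff (fun x : ℝ => x ^ 2 - x ^ 4) S, ← hg]
    exact star_mul_self_nonneg T
  have habs : CFC.abs T = cfc (fun x : ℝ => Real.sqrt (x ^ 2 - x ^ 4)) S := by
    refine CFC.sqrt_unique ?_ (cfc_nonneg fun x _ => Real.sqrt_nonneg _)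
    rw [hg, ← cfc_mul _ _ S]
    exact cfc_congr fun x hx => Real.mul_self_sqrt (hspec x hx)
  rw [CFC.rpow_eq_cfc_real (CFC.abs_nonneg T), CFC.rpow_eq_cfc_real hS0, habs,
    ← cfc_comp' (fun x : ℝ => x ^ p) (fun x : ℝ => Real.sqrt (x ^ 2 - x ^ 4)) S
      (Real.continuous_rpow_const hp).continuousOn]
  refine cfc_mono (fun x hx => ?_) ?_ (Real.continuous_rpow_const hp).continuousOn
  · have hx0 : 0 ≤ x := spectrum_nonneg_of_nonneg hS0 hx
    refine Real.rpow_le_rpow (Real.sqrt_nonneg _) ?_ hp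
    exact Real.sqrt_le_iff.2 ⟨hx0, by nlinarith [sq_nonneg (x ^ 2)]⟩
  · exact ((Real.continuous_rpow_const hp).comp (by fun_prop)).continuousOn

theorem commutator_mem_schatten {P E : H →L[ℂ] H} (hP : IsStarProjection P)
    (hE : IsStarProjection E) {p : ℝ} (hp : 0 ≤ p) (h : P - E ∈ schatten H p) :
    P * E - E * P ∈ schatten H p := by
  refine schatten_of_star_mul_self_eq hp h ?_
  have hP2 : P * P = P := hP.isIdempotentElem
  have hE2 : E * E = E := hE.isIdempotentElem
  have hPs : star P = P := hP.isSelfAdjoint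
  have hEs : star E = E := hE.isSelfAdjoint
  have hD : CFC.abs (P - E) ^ 2 = P + E - P * E - E * P := by
    rw [CFC.abs_sq, star_sub, hPs, hEs, sub_mul, mul_sub, mul_sub, hP2, hE2]
    abel
  have hP3 : ∀ X, P * (P * X) = P * X := fun X => by rw [← mul_assoc, hP2]
  have hE3 : ∀ X, E * (E * X) = E * X := fun X => by rw [← mul_assoc, hE2]
  rw [show (4 : ℕ) = 2 + 2 from rfl, pow_add, hD, star_sub, star_mul, star_mul, hPs, hEs]
  simp only [mul_add, add_mul, mul_sub, sub_mul, mul_assoc, hP2, hE2, hP3, hE3]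
  abel

theorem abs_apply_eq_self {D : H →L[ℂ] H} (hD : IsSelfAdjoint D) {v : H} (hv : D (D v) = v) :
    CFC.abs D v = v := by
  set S := CFC.abs D
  have hS : S (S v) = v := by
    have h := congrArg (fun T : H →L[ℂ] H => T v) (CFC.abs_mul_abs D)
    rw [hD.star_eq] at h
    exact h.trans hv
  have hw : S (S v - v) = -(S v - v) := by rw [map_sub, hS, neg_sub]
  have hpos : (0 : ℝ) ≤ RCLike.re ⟪S v - v, S (S v - v)⟫_ℂ :=
    ((ContinuousLinearMap.nonneg_iff_isPositive S).1 (CFC.abs_nonneg D)).re_inner_nonneg_right _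
  rw [hw, inner_neg_right, map_neg, inner_self_eq_norm_sq] at hpos
  have : ‖S v - v‖ = 0 := by nlinarith [norm_nonneg (S v - v)]
  exact sub_eq_zero.1 (norm_eq_zero.1 this)

theorem norm_sq_le_inner_abs_rpow {D : H →L[ℂ] H} (hD : IsSelfAdjoint D) {p : ℝ} (hp : 1 ≤ p)
    {v : H} (hv : D (D v) = v) :
    ‖v‖ ^ 2 ≤ RCLike.re ⟪v, (CFC.abs D ^ p) v⟫_ℂ := by
  have hSv := abs_apply_eq_self hD hv
  set S := CFC.abs D
  have hS0 : 0 ≤ S := CFC.abs_nonneg D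
  have hSa : IsSelfAdjoint S := hS0.isSelfAdjoint
  have hle : 1 + p • (S - 1) ≤ S ^ p := by
    have h1 : 1 + p • (S - 1) = cfc (fun x : ℝ => 1 + p • (x - 1)) S := by
      rw [cfc_const_add (R := ℝ) 1 (fun x : ℝ => p • (x - 1)) S, cfc_smul p (fun x : ℝ => x - 1) S,
        cfc_sub (fun x : ℝ => x) (fun _ => 1) S, cfc_id' ℝ S, cfc_const_one ℝ S, map_one]
    rw [h1, CFC.rpow_eq_cfc_real hS0]
    refine cfc_mono (fun x hx => ?_) (by fun_prop)
      (Real.continuous_rpow_const (by linarith)).continuousOn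
    have hx0 : 0 ≤ x := spectrum_nonneg_of_nonneg hS0 hx
    simpa using one_add_mul_self_le_rpow_one_add (s := x - 1) (by linarith) hp
  have := ((ContinuousLinearMap.le_def _ _).1 hle).re_inner_nonneg_right v
  simp only [sub_apply, add_apply, smul_apply, one_apply_eq_self,
    hSv, sub_self, smul_zero, add_zero, inner_sub_right, map_sub, inner_self_eq_norm_sq] at this
  linarith

theorem finite_of_orthonormal {D : H →L[ℂ] H} (hD : IsSelfAdjoint D) {p : ℝ} (hp : 1 ≤ p)
    (hDp : D ∈ schatten H p) {s : Set H} (hs : Orthonormal ℂ ((↑) : s → H))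
    (hsD : ∀ v ∈ s, D (D v) = v) : s.Finite := by
  obtain ⟨w, b, hsw, hb⟩ := hs.exists_hilbertBasis_extension
  have htop : posTrace (CFC.abs D ^ p) ≠ ∞ := hDp.ne
  rw [posTrace_eq_diagSum b CFC.rpow_nonneg] at htop
  have hfin := ENNReal.finite_const_le_of_tsum_ne_top htop one_ne_zero
  refine (hfin.image ((↑) : w → H)).subset fun v hv => ⟨⟨v, hsw hv⟩, ?_, rfl⟩
  have h := norm_sq_le_inner_abs_rpow hD hp (hsD v hv)
  have h1 : ‖v‖ = 1 := hs.1 ⟨v, hv⟩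
  rw [h1, one_pow] at h
  simpa [hb] using h

theorem finiteDimensional_of_apply_apply_eq {D : H →L[ℂ] H} (hD : IsSelfAdjoint D) {p : ℝ}
    (hp : 1 ≤ p) (hDp : D ∈ schatten H p) {N : Submodule ℂ H} (hN : ∀ v ∈ N, D (D v) = v) :
    FiniteDimensional ℂ N := by
  let N₀ : Submodule ℂ H := (D * D - 1).ker
  have hmem : ∀ v, v ∈ N₀ ↔ D (D v) = v := fun v => by
    simp [N₀, LinearMap.mem_ker, sub_eq_zero]
  have hle : N ≤ N₀ := fun v hv => (hmem v).2 (hN v hv)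
  have : CompleteSpace N₀ := (D * D - 1).isClosed_ker.completeSpace_coe
  obtain ⟨w, b, hb⟩ := exists_hilbertBasis ℂ N₀
  have hfin : ((↑) '' w : Set H).Finite := by
    refine finite_of_orthonormal hD hp hDp ?_ ?_
    · have h := (b.orthonormal.comp_linearIsometry N₀.subtypeₗᵢ).toSubtypeRange
      convert h using 2 <;> simp [hb, Set.range_comp, Set.image_eq_range]
    · rintro _ ⟨v, -, rfl⟩
      exact (hmem v).1 v.2
  have hw : w.Finite := hfin.of_finite_image Subtype.val_injective.injOn
  have : Finite w := hw
  have : Fintype w := Fintype.ofFinite w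
  have : FiniteDimensional ℂ N₀ := b.toOrthonormalBasis.toBasis.finiteDimensional_of_finite
  exact Submodule.finiteDimensional_of_le hle

/-- Two closed subspaces in finite relative position, one of them infinite-dimensional, are
isometrically isomorphic. -/
theorem nonempty_linearIsometryEquiv {K L : Submodule ℂ H} [K.HasOrthogonalProjection]
    [L.HasOrthogonalProjection] (hL : ¬ FiniteDimensional ℂ L)
    (h₁ : FiniteDimensional ℂ ↥(L ⊓ Kᗮ)) (h₂ : FiniteDimensional ℂ ↥(K ⊓ Lᗮ)) :
    Nonempty (L ≃ₗᵢ[ℂ] K) := by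
  have hK : ¬ FiniteDimensional ℂ K := fun _ => hL (finiteDimensional_of_inf_orthogonal (K := K))
  have : CompleteSpace K := (isClosed_of_hasOrthogonalProjection K).completeSpace_coe
  have : CompleteSpace L := (isClosed_of_hasOrthogonalProjection L).completeSpace_coe
  obtain ⟨I, b, -⟩ := exists_hilbertBasis ℂ K
  obtain ⟨J, c, -⟩ := exists_hilbertBasis ℂ L
  have := infinite_of_hilbertBasis b hK
  have := infinite_of_hilbertBasis c hL
  have h1 : Cardinal.mk I ≤ Cardinal.mk J := mk_le_mk_of_hilbertBasis b c <|
    (finite_setOf_hilbertBasis_mem (N := K ⊓ Lᗮ) b).subset fun i hi => ⟨(b i).2, hi⟩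
  have h2 : Cardinal.mk J ≤ Cardinal.mk I := mk_le_mk_of_hilbertBasis c b <|
    (finite_setOf_hilbertBasis_mem (N := L ⊓ Kᗮ) c).subset fun i hi => ⟨(c i).2, hi⟩
  obtain ⟨e⟩ := Cardinal.eq.1 (h2.antisymm h1)
  let b' : HilbertBasis J ℂ K := HilbertBasis.mk (b.orthonormal.comp e e.injective) (by
    rw [Set.range_comp, e.surjective.range_eq, Set.image_univ, b.dense_span])
  exact ⟨c.repr.trans b'.repr.symm⟩

theorem exists_unitary_conj_starProjection {K L : Submodule ℂ H} [K.HasOrthogonalProjection]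
    [L.HasOrthogonalProjection] (φ : L ≃ₗᵢ[ℂ] K) (ψ : Lᗮ ≃ₗᵢ[ℂ] Kᗮ) :
    ∃ U ∈ unitary (H →L[ℂ] H), U * L.starProjection * star U = K.starProjection := by
  let e : H ≃ₗᵢ[ℂ] H := L.orthogonalDecomposition.trans
    ((LinearIsometryEquiv.withLpProdCongr 2 φ ψ).trans K.orthogonalDecomposition.symm)
  let U := Unitary.linearIsometryEquiv.symm e
  have he : ∀ x, e x = φ (L.orthogonalProjectionOnto x) + ψ (Lᗮ.orthogonalProjectionOnto x) := by
    intro x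
    simp [e]
  have hcomm : (U : H →L[ℂ] H) * L.starProjection = K.starProjection * U := by
    ext x
    change e (L.starProjection x) = K.starProjection (e x)
    have h1 : L.orthogonalProjectionOnto (L.starProjection x) = L.orthogonalProjectionOnto x :=
      Submodule.orthogonalProjectionOnto_mem_subspace_eq_self _
    have h2 : Lᗮ.orthogonalProjectionOnto (L.starProjection x) = 0 :=
      Submodule.orthogonalProjectionOnto_eq_zero_iff.2
        (L.le_orthogonal_orthogonal (L.starProjection_apply_mem x))
    have h3 : K.starProjection (ψ (Lᗮ.orthogonalProjectionOnto x) : H) = 0 :=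
      K.starProjection_apply_eq_zero_iff.2 (ψ _).2
    have h4 : K.starProjection (φ (L.orthogonalProjectionOnto x) : H) =
        φ (L.orthogonalProjectionOnto x) := Submodule.starProjection_eq_self_iff.2 (φ _).2
    rw [he, he, h1, h2, map_add, h3, h4, map_zero, Submodule.coe_zero]
  refine ⟨U, U.2, ?_⟩
  rw [hcomm, mul_assoc, (Unitary.mem_iff.1 U.2).2, mul_one]

/-- Projections with infinite-dimensional ranges and kernels differing by a Schatten class
operator are unitarily equivalent. -/
theorem exists_unitary_conj_of_sub_mem_schatten {K L : Submodule ℂ H} [K.HasOrthogonalProjection]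
    [L.HasOrthogonalProjection] {p : ℝ} (hp : 1 ≤ p) (hL : ¬ FiniteDimensional ℂ L)
    (hL' : ¬ FiniteDimensional ℂ Lᗮ)
    (h : K.starProjection - L.starProjection ∈ schatten H p) :
    ∃ U ∈ unitary (H →L[ℂ] H), U * L.starProjection * star U = K.starProjection := by
  have hD : IsSelfAdjoint (K.starProjection - L.starProjection) :=
    (isStarProjection_starProjection (U := K)).isSelfAdjoint.sub
      (isStarProjection_starProjection (U := L)).isSelfAdjoint
  have h₁ : FiniteDimensional ℂ ↥(L ⊓ Kᗮ) := finiteDimensional_of_apply_apply_eq hD hp h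
    fun v hv => apply_apply_eq_of_mem_inf_orthogonal hv
  have h₂ : FiniteDimensional ℂ ↥(K ⊓ Lᗮ) := finiteDimensional_of_apply_apply_eq hD hp h
    fun v hv => by
      rw [← neg_sub L.starProjection, neg_apply, neg_apply, map_neg, neg_neg]
      exact apply_apply_eq_of_mem_inf_orthogonal hv
  obtain ⟨φ⟩ := nonempty_linearIsometryEquiv hL h₁ h₂
  obtain ⟨ψ⟩ := nonempty_linearIsometryEquiv (K := Kᗮ) hL'
    (by rwa [Submodule.orthogonal_orthogonal, inf_comm])
    (by rwa [Submodule.orthogonal_orthogonal, inf_comm])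
  exact exists_unitary_conj_starProjection φ ψ

theorem orbit_eq {p : ℝ} (hp : 1 ≤ p) (L : Submodule ℂ H) [L.HasOrthogonalProjection]
    (hL : ¬ FiniteDimensional ℂ L) (hL' : ¬ FiniteDimensional ℂ Lᗮ) :
    orbit p L.starProjection =
      {P | P ∈ projections H ∧ P - L.starProjection ∈ schatten H p} := by
  have hp0 : 0 ≤ p := by linarith
  have hE : IsStarProjection L.starProjection := isStarProjection_starProjection
  ext P
  constructor
  · rintro ⟨U, ⟨⟨hUA, -⟩, hU⟩, rfl⟩
    refine ⟨hE.map (Unitary.conjStarAlgAut ℂ (H →L[ℂ] H) ⟨U, hU⟩), ?_⟩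
    have : U * L.starProjection * star U - L.starProjection =
        (U * L.starProjection - L.starProjection * U) * star U := by
      rw [sub_mul, mul_assoc _ U, (Unitary.mem_iff.1 hU).2, mul_one]
    rw [this]
    exact schatten_mul_star_unitary hp0 hUA hU
  · rintro ⟨hP, h⟩
    obtain ⟨_, hPK⟩ := isStarProjection_iff_eq_starProjection_range.1 hP
    rw [hPK] at h
    obtain ⟨U, hU, hUE⟩ := exists_unitary_conj_of_sub_mem_schatten hp hL hL' h
    rw [← hPK] at h hUE
    have hU1 := (Unitary.mem_iff.1 hU).1
    have hU2 := (Unitary.mem_iff.1 hU).2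
    refine ⟨U, ⟨⟨?_, star U, ?_, hU2, hU1⟩, hU⟩, hUE.symm⟩
    · have : U * L.starProjection - L.starProjection * U = (P - L.starProjection) * U := by
        rw [← hUE, sub_mul, mul_assoc _ (star U), hU1, mul_one]
      change _ ∈ schatten H p
      rw [this]
      exact schatten_mul_unitary hp0 h hU
    · have : star U * L.starProjection - L.starProjection * star U =
          -(star U * (P - L.starProjection)) := by
        rw [← hUE, mul_sub, ← mul_assoc, ← mul_assoc, hU1, one_mul, neg_sub]
      change _ ∈ schatten H p
      rw [this]
      exact schatten_neg (schatten_unitary_mul h (Unitary.star_mem hU))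

theorem projectionsP_inter_eq {p : ℝ} (hp : 0 ≤ p) {E : H →L[ℂ] H} (hE : IsStarProjection E) :
    {P | P ∈ projectionsP p E ∧ P - E ∈ schatten H p} =
      {P | P ∈ projections H ∧ P - E ∈ schatten H p} := by
  ext P
  exact ⟨fun h => ⟨h.1.1, h.2⟩, fun h => ⟨⟨h.1, commutator_mem_schatten h.1 hE hp h.2⟩, h.2⟩⟩

end Schatten

end RestrictedProjections

end

theorem mainTheorem4 {H : Type*} [NormedAddCommGroup H] [InnerProductSpace ℂ H] [CompleteSpace H]
    (p : ℝ) (hp : 1 ≤ p)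
    (Hplus : Submodule ℂ H) [Hplus.HasOrthogonalProjection]
    (hplus : ¬ FiniteDimensional ℂ Hplus) (hminus : ¬ FiniteDimensional ℂ Hplusᗮ) :
    RestrictedProjections.orbit p Hplus.starProjection =
        {P | P ∈ RestrictedProjections.projectionsP p Hplus.starProjection ∧
          P - Hplus.starProjection ∈ RestrictedProjections.schatten H p} ∧
      {P | P ∈ RestrictedProjections.projectionsP p Hplus.starProjection ∧
          P - Hplus.starProjection ∈ RestrictedProjections.schatten H p} =
        {P | P ∈ RestrictedProjections.projections H ∧
          P - Hplus.starProjection ∈ RestrictedProjections.schatten H p} := by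
  have h := RestrictedProjections.projectionsP_inter_eq (p := p) (by linarith)
    (isStarProjection_starProjection (U := Hplus))
  exact ⟨(RestrictedProjections.orbit_eq hp Hplus hplus hminus).trans h.symm, h⟩
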